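/- Let $\mathbf{Met}$ be the category of extended metric spaces (metrics with values in $[0,\infty]$) and nonexpansive maps. For extended metric spaces $A,M$ let $M^A$ be the space of nonexpansive maps $A\to M$ with the supremum metric. A monad $T$ on $\mathbf{Met}$ is *enriched* if each map $\mathbf{Met}(X,Y)\to\mathbf{Met}(TX,TY)$, $f\mapsto T(f)$, is nonexpansive for the supremum metrics, and it is of *countable arity* if it preserves countably filtered ($\aleph_1$-filtered) colimits. A *metric signature* $\Omega$ is a set of operation symbols $f$, each with an arity, which is a countable extended metric space. *Preterms* are built from a fixed countably infinite set of variables by the rule: if $f$ has arity $A$ and $(t_i)_{i\in A}$ are preterms, then $f((t_i)_{i\in A})$ is a preterm. A *context* $\Gamma$ is a (possibly infinite) set of formal equalities $x=_\varepsilon y$ between variables, $\varepsilon\in[0,\infty)$. A *judgment* is $\Gamma\vdash t\ \mathrm{ok}$ or $\Gamma\vdash s=_\varepsilon t$ with preterms $s,t$ and $\varepsilon\in[0,\infty)$. For a set $S$ of judgments, $\vdash_S$ is the least set of judgments that contains $S$ and is closed under the following rules. * $\Gamma\vdash x\ \mathrm{ok}$ for every variable $x$; $\Gamma\vdash x=_\varepsilon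 y$ if $(x=_\varepsilon y)\in\Gamma$. * If $\Gamma\vdash t\ \mathrm{ok}$, then $\Gamma\vdash t=_0 t$. If $\Gamma\vdash s=_\varepsilon t$, then $\Gamma\vdash t=_\varepsilon s$, and $\Gamma\vdash s=_{\varepsilon'}t$ for all $\varepsilon'>\varepsilon$. If $\Gamma\vdash r=_\varepsilon s$ and $\Gamma\vdash s=_{\varepsilon'}t$, then $\Gamma\vdash r=_{\varepsilon+\varepsilon'}t$. If $\Gamma\vdash s=_{\varepsilon'}t$ for all $\varepsilon'>\varepsilon$, then $\Gamma\vdash s=_\varepsilon t$. * Let $f$ have arity $(A,d)$. If $\Gamma\vdash t_i\ \mathrm{ok}$ for all $i\in A$ and $\Gamma\vdash t_i=_{d(i,j)}t_j$ whenever $d(i,j)<\infty$, then $\Gamma\vdash f((t_i))\ \mathrm{ok}$. If $\Gamma\vdash s_i=_{d(i,j)}s_j$ and $\Gamma\vdash t_i=_{d(i,j)}t_j$ whenever $d(i,j)<\infty$, and $\Gamma\vdash s_i=_\varepsilon t_i$ for all $i\in A$, then $\Gamma\vdash f((s_i))=_\varepsilon f((t_i))$. * Let $\sigma$ be a substitution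 of preterms for variables. If $\Gamma\vdash\sigma(x)\ \mathrm{ok}$ for all variables $x$, $\Gamma\vdash\sigma(x)=_\delta\sigma(y)$ for all $(x=_\delta y)\in\Delta$, and $\Delta\vdash s=_\varepsilon t$, then $\Gamma\vdash s[\sigma]=_\varepsilon t[\sigma]$. A *metric equational theory* $\mathcal T$ over $\Omega$ is a set of judgments that contains $\Gamma\vdash s\ \mathrm{ok}$ and $\Gamma\vdash t\ \mathrm{ok}$ whenever it contains $\Gamma\vdash s=_\varepsilon t$, and that equals $\vdash_{\mathcal T^=}$, where $\mathcal T^=$ is the set of judgments of the form $\Gamma\vdash s=_\varepsilon t$ in $\mathcal T$. It is a *quantitative equational theory* if all arities of $\Omega$ are discrete (distinct points have distance $\infty$). A *model* of $\Omega$ is an extended metric space $M$ with a nonexpansive map $M[f]\colon M^A\to M$ for each symbol $f$ of arity $A$; a homomorphism is a nonexpansive map commuting with the operations. Under an assignment $\alpha$ of the variables to points of $M$, a preterm $f((t_i)_{i\in A})$ is defined if all $t_i$ are and their values form a nonexpansive family $A\to M$, and its value is then $M[f]$ of this family; a variable $x$ has value $\alpha(x)$. The model $M$ satisfies $\Gamma\vdash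 t\ \mathrm{ok}$ (resp. $\Gamma\vdash s=_\varepsilon t$) if for every assignment satisfying all $x=_\delta y$ in $\Gamma$ (that is, $d(\alpha(x),\alpha(y))\le\delta$) the preterm $t$ is defined (resp. $s,t$ are defined and their values have distance at most $\varepsilon$). $\mathrm{Mod}(\mathcal T)$ is the full subcategory of models of $\Omega$ that satisfy all judgments of $\mathcal T$. The theory $\mathcal T$ *axiomatizes* a monad $T$ on $\mathbf{Met}$ if $T$ is isomorphic, as a monad, to the free-model monad of $\mathcal T$, i.e. the monad induced by the forgetful functor $\mathrm{Mod}(\mathcal T)\to\mathbf{Met}$ and its left adjoint. **Theorem.** Let $T$ be an enriched monad of countable arity on $\mathbf{Met}$. Then $T$ is axiomatized by some quantitative equational theory if and only if $T$ preserves surjections, i.e. $T(f)\colon TX\to TY$ is surjective for every surjective nonexpansive map $f\colon X\to Y$. -/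

import Mathlib

open CategoryTheory
open scoped NNReal ENNReal

universe u v w

/-! ### Extended metric spaces and nonexpansive maps -/

/-- Nonexpansive maps between extended metric spaces. -/
structure NonexpMap (A : Type u) (B : Type v) [EMetricSpace A] [EMetricSpace B] where
  toFun : A → B
  nonexp' : ∀ x y, edist (toFun x) (toFun y) ≤ edist x y

namespace NonexpMap

section

variable {A : Type u} {B : Type v} {C : Type w} [EMetricSpace A] [EMetricSpace B] [EMetricSpace C]

instance : FunLike (NonexpMap A B) A B where
  coe := toFun
  coe_injective f g h := by cases f; cases g; congr

@[ext]
theorem ext {f g : NonexpMap A B} (h : ∀ x, f x = g x) : f = g := DFunLike.ext f g h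

theorem nonexp (f : NonexpMap A B) (x y : A) : edist (f x) (f y) ≤ edist x y := f.nonexp' x y

/-- The identity map. -/
def id (A : Type u) [EMetricSpace A] : NonexpMap A A := ⟨fun x => x, fun _ _ => le_rfl⟩

/-- Composition `g ∘ f`. -/
def comp (g : NonexpMap B C) (f : NonexpMap A B) : NonexpMap A C :=
  ⟨fun x => g (f x), fun x y => (g.nonexp _ _).trans (f.nonexp x y)⟩

@[simp] theorem mk_apply (f : A → B) (hf : ∀ x y, edist (f x) (f y) ≤ edist x y) (x : A) :
    (⟨f, hf⟩ : NonexpMap A B) x = f x := rfl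

@[simp] theorem id_apply (x : A) : NonexpMap.id A x = x := rfl

@[simp] theorem comp_apply (g : NonexpMap B C) (f : NonexpMap A B) (x : A) :
    g.comp f x = g (f x) := rfl

/-- The power `B ^ A`: nonexpansive maps with the supremum metric. -/
noncomputable instance : EMetricSpace (NonexpMap A B) where
  edist f g := ⨆ x, edist (f x) (g x)
  edist_self f := by simp
  edist_comm f g := by simp only [edist_comm]
  edist_triangle f g h := iSup_le fun x =>
    (edist_triangle _ (g x) _).trans
      (add_le_add (le_iSup (fun x => edist (f x) (g x)) x) (le_iSup (fun x => edist (g x) (h x)) x))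
  eq_of_edist_eq_zero {f g} h := by
    ext x
    have hx : edist (f x) (g x) ≤ 0 := (le_iSup (fun x => edist (f x) (g x)) x).trans_eq h
    exact edist_le_zero.mp hx

theorem edist_def (f g : NonexpMap A B) : edist f g = ⨆ x, edist (f x) (g x) := rfl

end

end NonexpMap

/-- The category `Met` of extended metric spaces and nonexpansive maps. -/
structure Met : Type (u + 1) where
  of ::
  carrier : Type u
  [str : EMetricSpace carrier]

attribute [instance] Met.str

namespace Met

instance : CoeSort Met.{u} (Type u) := ⟨carrier⟩

instance : LargeCategory.{u} Met.{u} where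
  Hom X Y := NonexpMap X Y
  id X := NonexpMap.id X
  comp f g := NonexpMap.comp g f

instance : ConcreteCategory Met.{u} (fun X Y => NonexpMap X Y) where
  hom f := f
  ofHom f := f

end Met

/-- An endofunctor of `Met` is enriched (strong) if it is nonexpansive on hom-spaces. -/
def IsMetEnriched (F : Met.{u} ⥤ Met.{u}) : Prop :=
  ∀ (X Y : Met.{u}) (f g : X ⟶ Y),
    edist (ConcreteCategory.hom (F.map f)) (ConcreteCategory.hom (F.map g)) ≤
      edist (ConcreteCategory.hom f) (ConcreteCategory.hom g)

/-- An endofunctor of `Met` has countable arity if it is `ℵ₁`-accessible, i.e. preserves (small)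
countably filtered colimits. -/
def HasCountableArity (F : Met.{u} ⥤ Met.{u}) : Prop :=
  haveI : Fact (Cardinal.aleph.{u} 1).IsRegular := ⟨Cardinal.isRegular_aleph_one⟩
  F.IsCardinalAccessible (Cardinal.aleph.{u} 1)

/-- `F` preserves surjections. -/
def PreservesSurjections (F : Met.{u} ⥤ Met.{u}) : Prop :=
  ∀ (X Y : Met.{u}) (f : X ⟶ Y),
    Function.Surjective (ConcreteCategory.hom f) →
      Function.Surjective (ConcreteCategory.hom (F.map f))

/-! ### Syntax -/

/-- A metric signature: operation symbols whose arities are countable extended metric spaces. -/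
structure MetricSignature where
  Op : Type u
  Arity : Op → Type
  [countableArity : ∀ f, Countable (Arity f)]
  [metricArity : ∀ f, EMetricSpace (Arity f)]

attribute [instance] MetricSignature.countableArity MetricSignature.metricArity

/-- All arities are discrete: distinct elements are at distance `∞`. -/
def MetricSignature.IsDiscrete (Ω : MetricSignature.{u}) : Prop :=
  ∀ (f : Ω.Op) (i j : Ω.Arity f), i ≠ j → edist i j = ⊤

/-- Preterms over the countably infinite set of variables `ℕ`. -/
inductive Preterm (Ω : MetricSignature.{u}) : Type u
  | var (x : ℕ) : Preterm Ω
  | app (f : Ω.Op) (t : Ω.Arity f → Preterm Ω) : Preterm Ω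

namespace Preterm

variable {Ω : MetricSignature.{u}}

/-- Simultaneous substitution of preterms for variables. -/
def subst (σ : ℕ → Preterm Ω) : Preterm Ω → Preterm Ω
  | var x => σ x
  | app f t => app f fun i => (t i).subst σ

end Preterm

/-- A quantitative equality `x =_ε y` between variables. -/
structure VarEq where
  lhs : ℕ
  rhs : ℕ
  bound : ℝ≥0

/-- A context: a (possibly infinite) collection of quantitative equalities between variables. -/
abbrev MetContext : Type := Set VarEq

/-- The atoms `t ok` and `s =_ε t`. -/
inductive MetAtom (Ω : MetricSignature.{u}) : Type u
  | ok (t : Preterm Ω) : MetAtom Ω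
  | eq (s t : Preterm Ω) (ε : ℝ≥0) : MetAtom Ω

/-- A judgment `Γ ⊢ φ`. -/
structure Judgment (Ω : MetricSignature.{u}) where
  ctx : MetContext
  atom : MetAtom Ω

open Preterm MetAtom in
/-- `Derivable S Γ φ`: the judgment `Γ ⊢ φ` belongs to the least deducibility relation containing
the set `S` of judgments. -/
inductive Derivable {Ω : MetricSignature.{u}} (S : Set (Judgment Ω)) :
    MetContext → MetAtom Ω → Prop
  | ax {Γ : MetContext} {φ : MetAtom Ω} (h : ⟨Γ, φ⟩ ∈ S) : Derivable S Γ φ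
  | var (Γ : MetContext) (x : ℕ) : Derivable S Γ (ok (var x))
  | assum {Γ : MetContext} {x y : ℕ} {ε : ℝ≥0} (h : ⟨x, y, ε⟩ ∈ Γ) :
      Derivable S Γ (eq (var x) (var y) ε)
  | refl {Γ : MetContext} {t : Preterm Ω} (h : Derivable S Γ (ok t)) : Derivable S Γ (eq t t 0)
  | symm {Γ : MetContext} {s t : Preterm Ω} {ε : ℝ≥0} (h : Derivable S Γ (eq s t ε)) :
      Derivable S Γ (eq t s ε)
  | triang {Γ : MetContext} {r s t : Preterm Ω} {ε ε' : ℝ≥0} (h : Derivable S Γ (eq r s ε))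
      (h' : Derivable S Γ (eq s t ε')) : Derivable S Γ (eq r t (ε + ε'))
  | max {Γ : MetContext} {s t : Preterm Ω} {ε ε' : ℝ≥0} (hε : ε' < ε)
      (h : Derivable S Γ (eq s t ε')) : Derivable S Γ (eq s t ε)
  | cont {Γ : MetContext} {s t : Preterm Ω} {ε : ℝ≥0}
      (h : ∀ ε' : ℝ≥0, ε < ε' → Derivable S Γ (eq s t ε')) : Derivable S Γ (eq s t ε)
  | nexp {Γ : MetContext} (f : Ω.Op) (s t : Ω.Arity f → Preterm Ω) (ε : ℝ≥0)
      (hs : ∀ (i j : Ω.Arity f) (δ : ℝ≥0), edist i j = δ → Derivable S Γ (eq (s i) (s j) δ))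
      (ht : ∀ (i j : Ω.Arity f) (δ : ℝ≥0), edist i j = δ → Derivable S Γ (eq (t i) (t j) δ))
      (hst : ∀ i, Derivable S Γ (eq (s i) (t i) ε)) :
      Derivable S Γ (eq (app f s) (app f t) ε)
  | subst {Γ Δ : MetContext} {s t : Preterm Ω} {ε : ℝ≥0} (σ : ℕ → Preterm Ω)
      (hok : ∀ x, Derivable S Γ (ok (σ x)))
      (hσ : ∀ e ∈ Δ, Derivable S Γ (eq (σ e.lhs) (σ e.rhs) e.bound))
      (h : Derivable S Δ (eq s t ε)) :
      Derivable S Γ (eq (s.subst σ) (t.subst σ) ε)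
  | app {Γ : MetContext} (f : Ω.Op) (t : Ω.Arity f → Preterm Ω)
      (hok : ∀ i, Derivable S Γ (ok (t i)))
      (h : ∀ (i j : Ω.Arity f) (δ : ℝ≥0), edist i j = δ → Derivable S Γ (eq (t i) (t j) δ)) :
      Derivable S Γ (ok (app f t))

/-- The equational judgments in a collection of judgments. -/
def equationalPart {Ω : MetricSignature.{u}} (S : Set (Judgment Ω)) : Set (Judgment Ω) :=
  {j | j ∈ S ∧ ∃ s t ε, j.atom = MetAtom.eq s t ε}

/-- A metric equational theory over `Ω`: a well-formed collection of judgments which is the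
deducibility relation generated by its equational judgments. -/
structure MetricTheory (Ω : MetricSignature.{u}) where
  judgments : Set (Judgment Ω)
  wellFormed : ∀ (Γ : MetContext) (s t : Preterm Ω) (ε : ℝ≥0), ⟨Γ, .eq s t ε⟩ ∈ judgments →
    ⟨Γ, .ok s⟩ ∈ judgments ∧ ⟨Γ, .ok t⟩ ∈ judgments
  generated : ∀ (Γ : MetContext) (φ : MetAtom Ω),
    ⟨Γ, φ⟩ ∈ judgments ↔ Derivable (equationalPart judgments) Γ φ

/-! ### Models -/

/-- A model of the signature `Ω`: an extended metric space `M` with a nonexpansive map `M ^ A → M`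
for every operation symbol of arity `A`. -/
structure SigModel (Ω : MetricSignature.{u}) where
  space : Met.{u}
  op : ∀ f : Ω.Op, NonexpMap (NonexpMap (Ω.Arity f) space) space

namespace SigModel

variable {Ω : MetricSignature.{u}}

/-- Homomorphisms: nonexpansive maps commuting with all operations. -/
@[ext]
structure Hom (M N : SigModel Ω) where
  map : M.space ⟶ N.space
  map_op : ∀ (f : Ω.Op) (a : NonexpMap (Ω.Arity f) M.space),
    ConcreteCategory.hom map (M.op f a) = N.op f ((ConcreteCategory.hom map).comp a)

/-- The category `Mod(Ω)`. -/
instance : LargeCategory.{u} (SigModel.{u} Ω) where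
  Hom := Hom
  id M := ⟨𝟙 M.space, fun _ _ => rfl⟩
  comp φ ψ := ⟨φ.map ≫ ψ.map, fun f a =>
    (congrArg (ConcreteCategory.hom ψ.map) (φ.map_op f a)).trans (ψ.map_op f _)⟩

/-- The underlying metric space of a model of `Ω`. -/
def forget (Ω : MetricSignature.{u}) : SigModel Ω ⥤ Met.{u} where
  obj M := M.space
  map φ := φ.map

/-- `M.Eval α t m`: under the assignment `α` the preterm `t` is defined in `M` with value `m`. An
application `f(tᵢ)` is defined if all `tᵢ` are, and their values form a point of `M ^ A`, where `A`
is the arity of `f`. -/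
inductive Eval (M : SigModel Ω) (α : ℕ → M.space) : Preterm Ω → M.space → Prop
  | var (x : ℕ) : Eval M α (.var x) (α x)
  | app (f : Ω.Op) (t : Ω.Arity f → Preterm Ω) (a : NonexpMap (Ω.Arity f) M.space)
      (h : ∀ i, Eval M α (t i) (a i)) : Eval M α (.app f t) (M.op f a)

/-- The assignment `α` satisfies the context `Γ`. -/
def SatCtx (M : SigModel Ω) (α : ℕ → M.space) (Γ : MetContext) : Prop :=
  ∀ e ∈ Γ, edist (α e.lhs) (α e.rhs) ≤ e.bound

/-- `M.Sat Γ φ`: the model `M` satisfies the judgment `Γ ⊢ φ`. The bound on the supremum distance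
between the interpretations of terms is spelled out pointwise. -/
def Sat (M : SigModel Ω) (Γ : MetContext) : MetAtom Ω → Prop
  | .ok t => ∀ α, M.SatCtx α Γ → ∃ m, M.Eval α t m
  | .eq s t ε => ∀ α, M.SatCtx α Γ → ∃ m n, M.Eval α s m ∧ M.Eval α t n ∧ edist m n ≤ ε

end SigModel

namespace MetricTheory

variable {Ω : MetricSignature.{u}}

/-- The models of the signature satisfying every judgment of the theory. -/
def isModel (𝒯 : MetricTheory Ω) : ObjectProperty (SigModel Ω) :=
  fun M => ∀ j ∈ 𝒯.judgments, M.Sat j.ctx j.atom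

/-- The category `Mod(𝒯)` of models of a theory, a full subcategory of `Mod(Ω)`. -/
abbrev Mod (𝒯 : MetricTheory Ω) := 𝒯.isModel.FullSubcategory

/-- The forgetful functor `Mod(𝒯) ⥤ Met`. -/
def forget (𝒯 : MetricTheory Ω) : 𝒯.Mod ⥤ Met.{u} := 𝒯.isModel.ι ⋙ SigModel.forget Ω

/-- `𝒯` axiomatizes the monad `T`: the forgetful functor `Mod(𝒯) ⥤ Met` has a left adjoint (the free
model functor) and the monad of this adjunction is isomorphic to `T`. -/
def Axiomatizes (𝒯 : MetricTheory Ω) (T : Monad Met.{u}) : Prop :=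
  ∃ (F : Met.{u} ⥤ 𝒯.Mod) (adj : F ⊣ 𝒯.forget), Nonempty (adj.toMonad ≅ T)

end MetricTheory

/-- `T` is axiomatizable by a quantitative equational theory, i.e. by a metric equational theory
all of whose operations have discrete arity. -/
def IsQETAxiomatizable (T : Monad Met.{u}) : Prop :=
  ∃ Ω : MetricSignature.{u}, Ω.IsDiscrete ∧ ∃ 𝒯 : MetricTheory Ω, 𝒯.Axiomatizes T

/-! Over a discrete signature every family is nonexpansive, so every preterm is defined and every
subset closed under the operations is a submodel satisfying the same judgments. For a surjection `X
→ Y`, the image of `TX → TY` is such a submodel containing the generators, so by freeness it is all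
of `TY` (`MetricTheory.surjective_of_adjunction`).

Conversely, let the elements of `T` at the discrete space on `S ⊆ ℕ` be the operations of arity `S`,
acting on each `TX` by Kleisli extension, and take all judgments valid in every `TX`. The point is
that `TX` is the free model on `X`. For countable `X` choose a surjection from a countable discrete
space. As `T` preserves it, every element of `TX` is a term in points of `X`, which forces the
extension of a map `X → M`. Bounds on distances between such terms are judgments whose context
records the metric of `X`; valid in all `TY`, they hold in `M` (`edist_evl_le`,
`exists_extension_of_countable`). Countable arity carries this to every `X`, the countably directed
colimit of its countable subspaces (`exists_extension`). -/

open CategoryTheory.Limits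

/-! ### Nonexpansive maps out of discrete spaces -/

/-- Any function out of a discrete extended metric space is nonexpansive. -/
def NonexpMap.ofDiscrete {A : Type v} {B : Type w} [EMetricSpace A] [EMetricSpace B]
    (h : ∀ i j : A, i ≠ j → edist i j = ⊤) (g : A → B) : NonexpMap A B :=
  ⟨g, fun i j => by
    by_cases hij : i = j
    · subst hij; simp
    · simp [h i j hij]⟩

theorem NonexpMap.edist_le_iff {A : Type u} {B : Type v} [EMetricSpace A] [EMetricSpace B]
    {f g : NonexpMap A B} {c : ℝ≥0∞} : edist f g ≤ c ↔ ∀ x, edist (f x) (g x) ≤ c := by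
  rw [NonexpMap.edist_def, iSup_le_iff]

/-- A type with the discrete extended metric. -/
def Disc (α : Type v) : Type v := α

namespace Disc

open Classical in
noncomputable instance (α : Type v) : EMetricSpace (Disc α) where
  edist a b := if a = b then 0 else ⊤
  edist_self a := by simp
  edist_comm a b := by simp only [eq_comm]
  edist_triangle a b c := by
    by_cases hab : a = b
    · subst hab; simp
    · simp [hab]
  eq_of_edist_eq_zero {a b} h := by
    by_contra hab
    simp [hab] at h

theorem edist_eq_top {α : Type v} (i j : Disc α) (h : i ≠ j) : edist i j = ⊤ := if_neg h

instance (α : Type v) [Countable α] : Countable (Disc α) := inferInstanceAs (Countable α)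

end Disc

/-! ### Evaluation of preterms in models of a discrete signature -/

namespace SigModel

variable {Ω : MetricSignature.{u}}

/-- The value of a preterm in a model of a discrete signature. -/
noncomputable def eval (hΩ : Ω.IsDiscrete) (M : SigModel Ω) (α : ℕ → M.space) : Preterm Ω → M.space
  | .var x => α x
  | .app f t => M.op f (NonexpMap.ofDiscrete (hΩ f) fun i => eval hΩ M α (t i))

theorem eval_spec (hΩ : Ω.IsDiscrete) (M : SigModel Ω) (α : ℕ → M.space) (t : Preterm Ω) :
    M.Eval α t (M.eval hΩ α t) := by
  induction t with
  | var x => exact .var x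
  | app f t ih => exact .app f t _ ih

theorem Eval.eq_eval (hΩ : Ω.IsDiscrete) {M : SigModel Ω} {α : ℕ → M.space} {t : Preterm Ω}
    {m : M.space} (h : M.Eval α t m) : m = M.eval hΩ α t := by
  induction h with
  | var x => rfl
  | app f t a _ ih =>
    exact congrArg (M.op f) (NonexpMap.ext ih)

/-- Definedness imposes no metric condition when arities are discrete, so only the equational
judgments have content. -/
theorem sat_ok (hΩ : Ω.IsDiscrete) (M : SigModel Ω) (Γ : MetContext) (t : Preterm Ω) :
    M.Sat Γ (.ok t) := fun α _ => ⟨_, M.eval_spec hΩ α t⟩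

theorem sat_eq_iff (hΩ : Ω.IsDiscrete) (M : SigModel Ω) (Γ : MetContext) (s t : Preterm Ω)
    (ε : ℝ≥0) : M.Sat Γ (.eq s t ε) ↔
      ∀ α, M.SatCtx α Γ → edist (M.eval hΩ α s) (M.eval hΩ α t) ≤ ε := by
  refine forall₂_congr fun α _ => ⟨?_, fun h => ⟨_, _, M.eval_spec hΩ α s, M.eval_spec hΩ α t, h⟩⟩
  rintro ⟨m, n, hm, hn, h⟩
  rwa [hm.eq_eval hΩ, hn.eq_eval hΩ] at h

theorem eval_subst (hΩ : Ω.IsDiscrete) (M : SigModel Ω) (α : ℕ → M.space) (σ : ℕ → Preterm Ω)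
    (t : Preterm Ω) :
    M.eval hΩ α (t.subst σ) = M.eval hΩ (fun x => M.eval hΩ α (σ x)) t := by
  induction t with
  | var x => rfl
  | app f t ih => exact congrArg (M.op f) (NonexpMap.ext ih)

theorem hom_eval (hΩ : Ω.IsDiscrete) {M N : SigModel Ω} (h : M ⟶ N) (α : ℕ → M.space)
    (t : Preterm Ω) :
    ConcreteCategory.hom h.map (M.eval hΩ α t) =
      N.eval hΩ (fun x => ConcreteCategory.hom h.map (α x)) t := by
  induction t with
  | var x => rfl
  | app f t ih =>
    exact (h.map_op f _).trans (congrArg (N.op f) (NonexpMap.ext ih))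

/-- Soundness of deducibility over a discrete signature. -/
theorem sat_of_derivable (hΩ : Ω.IsDiscrete) (M : SigModel Ω) {S : Set (Judgment Ω)}
    (hS : ∀ j ∈ S, M.Sat j.ctx j.atom) {Γ : MetContext} {φ : MetAtom Ω}
    (h : Derivable S Γ φ) : M.Sat Γ φ := by
  induction h with
  | ax h => exact hS _ h
  | var Γ x => exact M.sat_ok hΩ _ _
  | app => exact M.sat_ok hΩ _ _
  | assum h => rw [sat_eq_iff hΩ]; exact fun α hα => hα _ h
  | refl => rw [sat_eq_iff hΩ]; intro α _; simp
  | symm _ ih =>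
    rw [sat_eq_iff hΩ] at ih ⊢
    intro α hα; rw [edist_comm]; exact ih α hα
  | triang _ _ ih ih' =>
    rw [sat_eq_iff hΩ] at ih ih' ⊢
    intro α hα
    rw [ENNReal.coe_add]
    exact (edist_triangle _ _ _).trans (add_le_add (ih α hα) (ih' α hα))
  | max hε _ ih =>
    rw [sat_eq_iff hΩ] at ih ⊢
    exact fun α hα => (ih α hα).trans (ENNReal.coe_le_coe.2 hε.le)
  | cont _ ih =>
    rw [sat_eq_iff hΩ]
    intro α hα
    refine ENNReal.le_of_forall_pos_le_add fun δ hδ _ => ?_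
    have := (sat_eq_iff hΩ _ _ _ _ _).1 (ih _ (lt_add_of_pos_right _ hδ)) α hα
    rwa [ENNReal.coe_add] at this
  | nexp f s t ε _ _ _ _ _ ih =>
    rw [sat_eq_iff hΩ]
    intro α hα
    exact ((M.op f).nonexp _ _).trans
      (NonexpMap.edist_le_iff.2 fun i => (sat_eq_iff hΩ _ _ _ _ _).1 (ih i) α hα)
  | subst σ _ _ _ _ hσ ih =>
    rw [sat_eq_iff hΩ] at ih ⊢
    intro α hα
    rw [eval_subst, eval_subst]
    exact ih _ fun e he => (sat_eq_iff hΩ _ _ _ _ _).1 (hσ e he) α hα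

/-! ### Images of homomorphisms; necessity of preserving surjections -/

/-- Over a discrete signature, submodels inherit satisfaction of judgments. -/
theorem sat_of_isometry (hΩ : Ω.IsDiscrete) {M N : SigModel Ω} (h : M ⟶ N)
    (hi : ∀ x y, edist (ConcreteCategory.hom h.map x) (ConcreteCategory.hom h.map y) = edist x y)
    {Γ : MetContext} {φ : MetAtom Ω} (hN : N.Sat Γ φ) : M.Sat Γ φ := by
  cases φ with
  | ok t => exact M.sat_ok hΩ _ _
  | eq s t ε =>
    rw [sat_eq_iff hΩ] at hN ⊢
    intro α hα
    have := hN (fun x => ConcreteCategory.hom h.map (α x)) fun e he => by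
      rw [hi]; exact hα e he
    rwa [← hom_eval, ← hom_eval, hi] at this

/-- The image of a homomorphism of models of a discrete signature. -/
noncomputable def image (hΩ : Ω.IsDiscrete) {M N : SigModel Ω} (h : M ⟶ N) : SigModel Ω where
  space := Met.of (Set.range (ConcreteCategory.hom h.map))
  op f := ⟨fun a => ⟨N.op f ⟨fun i => (a i).1, fun i j => a.nonexp i j⟩,
      -- Discreteness is essential here: arbitrarily chosen preimages again form a point of `M ^ A`.
      M.op f (NonexpMap.ofDiscrete (hΩ f) fun i => (a i).2.choose),
      (h.map_op f _).trans (congrArg (N.op f) (NonexpMap.ext fun i => (a i).2.choose_spec))⟩,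
    fun a b => ((N.op f).nonexp _ _).trans
      (NonexpMap.edist_le_iff.2 fun i => NonexpMap.edist_le_iff.1 (le_refl (edist a b)) i)⟩

/-- The inclusion of the image of a homomorphism. -/
noncomputable def imageι (hΩ : Ω.IsDiscrete) {M N : SigModel Ω} (h : M ⟶ N) : image hΩ h ⟶ N :=
  { map := (⟨fun x => x.1, fun _ _ => le_rfl⟩ :
      NonexpMap (Set.range (ConcreteCategory.hom h.map)) N.space)
    map_op := fun _ _ => rfl }

end SigModel

/-- A left adjoint of the forgetful functor of a quantitative equational theory preserves
surjections. -/
theorem MetricTheory.surjective_of_adjunction {Ω : MetricSignature.{u}} (hΩ : Ω.IsDiscrete)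
    (𝒯 : MetricTheory Ω) {F : Met.{u} ⥤ 𝒯.Mod} (adj : F ⊣ 𝒯.forget) :
    PreservesSurjections (F ⋙ 𝒯.forget) := by
  intro X Y f hf
  let φ : (F.obj X).obj ⟶ (F.obj Y).obj := (F.map f).hom
  let N : 𝒯.Mod := ⟨SigModel.image hΩ φ, fun j hj =>
    SigModel.sat_of_isometry hΩ (SigModel.imageι hΩ φ) (fun _ _ => rfl) ((F.obj Y).property j hj)⟩
  let i : N ⟶ F.obj Y := ObjectProperty.homMk (SigModel.imageι hΩ φ)
  -- Surjectivity of `f` and naturality of the unit put all generators in the image.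
  have hη : ∀ y, ConcreteCategory.hom (adj.unit.app Y) y ∈
      Set.range (ConcreteCategory.hom φ.map) := by
    intro y
    obtain ⟨x, rfl⟩ := hf y
    exact ⟨ConcreteCategory.hom (adj.unit.app X) x,
      (ConcreteCategory.congr_hom (adj.unit.naturality f) x).symm⟩
  let g : Y ⟶ 𝒯.forget.obj N :=
    (⟨fun y => ⟨_, hη y⟩, fun a b => NonexpMap.nonexp (adj.unit.app Y) a b⟩ :
      NonexpMap Y (Set.range (ConcreteCategory.hom φ.map)))
  -- The inclusion of the image has a section, as both sides agree on generators; hence it is onto.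
  have key : (adj.homEquiv Y N).symm g ≫ i = 𝟙 _ := by
    apply (adj.homEquiv Y _).injective
    rw [adj.homEquiv_naturality_right, Equiv.apply_symm_apply, adj.homEquiv_id]
    rfl
  intro y
  have h := ConcreteCategory.congr_hom (congrArg 𝒯.forget.map key) y
  have hy : y ∈ Set.range (ConcreteCategory.hom φ.map) := by
    have h' : (ConcreteCategory.hom (𝒯.forget.map ((adj.homEquiv Y N).symm g)) y).1 = y := h
    rw [← h']
    exact Subtype.property _
  exact hy

theorem PreservesSurjections.of_iso {F G : Met.{u} ⥤ Met.{u}} (e : F ≅ G)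
    (hF : PreservesSurjections F) : PreservesSurjections G := by
  intro X Y f hf y
  obtain ⟨x, hx⟩ := hF X Y f hf (ConcreteCategory.hom (e.inv.app Y) y)
  refine ⟨ConcreteCategory.hom (e.hom.app X) x, ?_⟩
  have h1 := ConcreteCategory.congr_hom (e.hom.naturality f) x
  have h2 := ConcreteCategory.congr_hom (e.inv_hom_id_app Y) y
  refine Eq.trans h1.symm (Eq.trans ?_ h2)
  exact congrArg (ConcreteCategory.hom (e.hom.app Y)) hx

/-! ### Countable subspaces -/

namespace Met

/-- The poset of countable subsets of a space. -/
abbrev CountableSubsets (X : Met.{u}) : Type u := {S : Set X // S.Countable}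

/-- The diagram of countable subspaces. -/
abbrev countableDiagram (X : Met.{u}) : CountableSubsets X ⥤ Met.{u} where
  obj S := Met.of S.1
  map h := (⟨fun x => ⟨x.1, leOfHom h x.2⟩, fun _ _ => le_rfl⟩ : NonexpMap _ _)

/-- The inclusion of a subspace. -/
def incl {X : Met.{u}} (S : Set X) : Met.of S ⟶ X :=
  (⟨fun x => x.1, fun _ _ => le_rfl⟩ : NonexpMap S X)

/-- A space as a cocone on its countable subspaces. -/
abbrev countableCocone (X : Met.{u}) : Cocone (countableDiagram X) where
  pt := X
  ι := { app := fun S => incl S.1 }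

/-- A space is the colimit of its countable subspaces. -/
def countableCoconeIsColimit (X : Met.{u}) : IsColimit (countableCocone X) where
  desc s := (⟨fun x => ConcreteCategory.hom (s.ι.app ⟨{x}, Set.countable_singleton x⟩)
      (⟨x, rfl⟩ : ({x} : Set X)), fun x y => by
    have hx : (⟨{x}, Set.countable_singleton x⟩ : CountableSubsets X) ≤
      ⟨{x, y}, (Set.countable_singleton y).insert x⟩ := by
        intro z hz; exact Or.inl hz
    have hy : (⟨{y}, Set.countable_singleton y⟩ : CountableSubsets X) ≤
      ⟨{x, y}, (Set.countable_singleton y).insert x⟩ := by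
        intro z hz; exact Or.inr hz
    -- Both values factor through the subspace `{x, y}`, where the distance is already visible.
    rw [← s.w (homOfLE hx), ← s.w (homOfLE hy)]
    exact NonexpMap.nonexp (s.ι.app ⟨{x, y}, (Set.countable_singleton y).insert x⟩)
      (⟨x, Or.inl rfl⟩ : ({x, y} : Set X)) (⟨y, Or.inr rfl⟩ : ({x, y} : Set X))⟩ :
      NonexpMap X s.pt)
  fac s S := by
    refine ConcreteCategory.hom_ext _ _ fun x => ?_
    have hx : (⟨{x.1}, Set.countable_singleton x.1⟩ : CountableSubsets X) ≤ S := by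
      intro z hz
      obtain rfl : z = x.1 := hz
      exact x.2
    have := ConcreteCategory.congr_hom (s.w (homOfLE hx)) (⟨x.1, rfl⟩ : ({x.1} : Set X))
    exact this.symm
  uniq s m hm := by
    refine ConcreteCategory.hom_ext _ _ fun x => ?_
    exact ConcreteCategory.congr_hom (hm ⟨{x}, Set.countable_singleton x⟩)
      (⟨x, rfl⟩ : ({x} : Set X))

theorem exists_countable_le {X : Met.{u}} {K : Type v} [Countable K]
    (s : K → CountableSubsets X) : ∃ j : CountableSubsets X, ∀ k, s k ≤ j :=
  ⟨⟨⋃ k, (s k).1, Set.countable_iUnion fun k => (s k).2⟩,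
    fun k => Set.subset_iUnion (fun k => (s k).1) k⟩

/-- The points of a colimit are in the images of the cocone maps. -/
theorem exists_of_isColimit {J : Type u} [SmallCategory J] {D : J ⥤ Met.{u}} {c : Cocone D}
    (hc : IsColimit c) (z : c.pt) :
    ∃ (j : J) (x : D.obj j), ConcreteCategory.hom (c.ι.app j) x = z := by
  let S : Set c.pt := {z | ∃ (j : J) (x : D.obj j), ConcreteCategory.hom (c.ι.app j) x = z}
  let c' : Cocone D :=
    { pt := Met.of S
      ι :=
        { app := fun j => (⟨fun x => ⟨ConcreteCategory.hom (c.ι.app j) x, j, x, rfl⟩,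
            fun x y => NonexpMap.nonexp (c.ι.app j) x y⟩ : NonexpMap (D.obj j) S)
          naturality := fun j k f => by
            refine ConcreteCategory.hom_ext _ _ fun x => Subtype.ext ?_
            exact ConcreteCategory.congr_hom (c.w f) x } }
  -- The union of the images is itself a cocone, so the identity of the colimit factors through it.
  have h : hc.desc c' ≫ incl S = 𝟙 _ := by
    refine hc.hom_ext fun j => ?_
    rw [← Category.assoc, hc.fac, Category.comp_id]
    rfl
  have h1 : (ConcreteCategory.hom (hc.desc c') z : S).1 = z := ConcreteCategory.congr_hom h z
  have h2 : (ConcreteCategory.hom (hc.desc c') z : S).1 ∈ S := Subtype.property _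
  rwa [h1] at h2

end Met

/-- A functor of countable arity preserves the colimit of countable subspaces. -/
theorem HasCountableArity.preservesColimit {F : Met.{u} ⥤ Met.{u}} (hF : HasCountableArity F)
    (X : Met.{u}) : Nonempty (IsColimit (F.mapCocone (Met.countableCocone X))) := by
  have : Fact (Cardinal.aleph.{u} 1).IsRegular := ⟨Cardinal.isRegular_aleph_one⟩
  have : F.IsCardinalAccessible (Cardinal.aleph.{u} 1) := hF
  have : IsCardinalFiltered (Met.CountableSubsets X) (Cardinal.aleph.{u} 1) :=
    isCardinalFiltered_preorder _ _ fun K s hK => by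
      have : Countable K := by
        rw [← Cardinal.mk_le_aleph0_iff]
        rwa [← Cardinal.succ_aleph0, Order.lt_succ_iff] at hK
      exact Met.exists_countable_le s
  have := F.preservesColimitsOfShape_of_isCardinalAccessible (Cardinal.aleph.{u} 1)
    (Met.CountableSubsets X)
  exact ⟨isColimitOfPreserves F (Met.countableCoconeIsColimit X)⟩

/-! ### The quantitative equational theory of a monad -/

namespace Met

/-- The discrete space on a set of natural numbers. -/
noncomputable def disc (S : Set ℕ) : Met.{u} := Met.of (Disc (ULift.{u} S))

/-- The nonexpansive map out of a discrete space given by a function. -/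
noncomputable def discHom {X : Met.{u}} {S : Set ℕ} (g : S → X) : disc.{u} S ⟶ X :=
  NonexpMap.ofDiscrete (A := Disc (ULift.{u} S)) Disc.edist_eq_top fun i => g i.down

theorem discHom_comp {X Y : Met.{u}} {S : Set ℕ} (g : S → X) (f : X ⟶ Y) :
    discHom g ≫ f = discHom fun i => ConcreteCategory.hom f (g i) := rfl

theorem discHom_surjective {X : Met.{u}} {S : Set ℕ} {g : S → X} (hg : Function.Surjective g) :
    Function.Surjective (ConcreteCategory.hom (discHom g)) := fun x => by
  obtain ⟨i, rfl⟩ := hg x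
  exact ⟨(ULift.up i : ULift.{u} S), rfl⟩

/-- Arities range over all subsets of `ℕ` because the empty space is not an image of `ℕ`. -/
theorem exists_surjective (X : Met.{u}) [Countable X] :
    ∃ (S : Set ℕ) (p : S → X), Function.Surjective p := by
  obtain ⟨e, he⟩ := exists_injective_nat X
  exact ⟨Set.range e, (Equiv.ofInjective e he).symm, (Equiv.ofInjective e he).symm.surjective⟩

end Met

namespace MonadTheory

open Met

variable (T : Monad Met.{u})

/-- The signature whose operations of arity `S`, a set of natural numbers, are the elements of the
value of the monad at the discrete space on `S`. -/
noncomputable abbrev signature : MetricSignature.{u} where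
  Op := Σ S : Set ℕ, T.obj (disc S)
  Arity f := Disc f.1

theorem signature_isDiscrete : (signature T).IsDiscrete := fun _ => Disc.edist_eq_top

variable {T}

/-- The operations of a model, applied to arbitrary families. -/
noncomputable def act (M : SigModel (signature T)) {S : Set ℕ} (z : T.obj (disc S)) (a : S → M.space) : M.space :=
  M.op ⟨S, z⟩ (NonexpMap.ofDiscrete (A := (signature T).Arity ⟨S, z⟩)
    (signature_isDiscrete T ⟨S, z⟩) a)

theorem map_act {M N : SigModel (signature T)} (h : M ⟶ N) {S : Set ℕ} (z : T.obj (disc S))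
    (a : S → M.space) : ConcreteCategory.hom h.map (act M z a) =
      act N z fun i => ConcreteCategory.hom h.map (a i) :=
  h.map_op _ _

/-- Maps commuting with the operations on arbitrary families are homomorphisms. -/
noncomputable def homOfMapAct {M N : SigModel (signature T)} (h : M.space ⟶ N.space)
    (H : ∀ (S : Set ℕ) (z : T.obj (disc S)) (a : S → M.space),
      ConcreteCategory.hom h (act M z a) = act N z fun i => ConcreteCategory.hom h (a i)) :
    M ⟶ N :=
  { map := h
    map_op := fun f a => H f.1 f.2 a }

/-- The evaluation of preterms. -/
noncomputable abbrev evl (M : SigModel (signature T)) (α : ℕ → M.space)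
    (t : Preterm (signature T)) : M.space :=
  M.eval (signature_isDiscrete T) α t

/-- The application of an operation to preterms. -/
noncomputable def opTerm {S : Set ℕ} (z : T.obj (disc S)) (t : S → Preterm (signature T)) :
    Preterm (signature T) :=
  .app (⟨S, z⟩ : Σ S : Set ℕ, T.obj (disc S)) t

theorem evl_opTerm (M : SigModel (signature T)) (α : ℕ → M.space) {S : Set ℕ}
    (z : T.obj (disc S)) (t : S → Preterm (signature T)) :
    evl M α (opTerm z t) = act M z fun i => evl M α (t i) := rfl

/-- An operation applied to variables. -/
noncomputable def varTerm {S : Set ℕ} (z : T.obj (disc S)) : Preterm (signature T) := opTerm z fun i => .var i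

/-! ### Free algebras as models, and the theory they define -/

variable (hE : IsMetEnriched T.toFunctor)

/-- The free algebra of an enriched monad, as a model of the signature. -/
noncomputable abbrev freeModel (X : Met.{u}) : SigModel (signature T) where
  space := T.obj X
  op f := ⟨fun a => ConcreteCategory.hom (T.μ.app X)
      (ConcreteCategory.hom (T.map (discHom fun i : f.1 => a i)) f.2), fun a b => by
    refine (NonexpMap.nonexp (T.μ.app X) _ _).trans ?_
    -- Enrichment of `T` is what makes the operations nonexpansive for the supremum metric.
    refine (NonexpMap.edist_le_iff.1 (hE _ _ _ _) f.2).trans ?_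
    exact NonexpMap.edist_le_iff.2 fun i =>
      NonexpMap.edist_le_iff.1 (le_refl (edist a b)) i.down⟩

theorem act_freeModel {X : Met.{u}} {S : Set ℕ} (z : T.obj (disc S)) (a : S → T.obj X) :
    act (freeModel hE X) z a =
      ConcreteCategory.hom (T.μ.app X) (ConcreteCategory.hom (T.map (discHom a)) z) := rfl

/-- By the right unit law, these elements are operations applied to generators, so homomorphisms are
determined on them by the unit. -/
theorem map_discHom_eq_act {X : Met.{u}} {S : Set ℕ} (z : T.obj (disc S)) (g : S → X) :
    ConcreteCategory.hom (T.map (discHom g)) z =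
      act (freeModel hE X) z fun i => ConcreteCategory.hom (T.η.app X) (g i) := by
  rw [act_freeModel]
  have h : T.map (discHom g) =
      T.map (discHom fun i => ConcreteCategory.hom (T.η.app X) (g i)) ≫ T.μ.app X := by
    rw [← discHom_comp, T.map_comp, Category.assoc, T.right_unit, Category.comp_id]
  exact ConcreteCategory.congr_hom h z

/-- The functorial action of the monad on free models. -/
noncomputable def freeModelMap {X Y : Met.{u}} (f : X ⟶ Y) : freeModel hE X ⟶ freeModel hE Y :=
  homOfMapAct (T.map f) fun S z a => by
    have h : (T.map (discHom a) ≫ T.μ.app X) ≫ T.map f =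
        T.map (discHom fun i => ConcreteCategory.hom (T.map f) (a i)) ≫ T.μ.app Y := by
      rw [← discHom_comp, T.map_comp, Category.assoc, Category.assoc]
      exact congrArg (_ ≫ ·) (T.μ.naturality f).symm
    exact ConcreteCategory.congr_hom h z

/-- The multiplication of the monad as a homomorphism of free models. -/
noncomputable def freeModelMul (X : Met.{u}) : freeModel hE (T.obj X) ⟶ freeModel hE X :=
  homOfMapAct (T.μ.app X) fun S z a => by
    have h : (T.map (discHom a) ≫ T.μ.app (T.obj X)) ≫ T.μ.app X =
        T.map (discHom fun i => ConcreteCategory.hom (T.μ.app X) (a i)) ≫ T.μ.app X := by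
      rw [← discHom_comp, T.map_comp, Category.assoc, Category.assoc, T.assoc]
    exact ConcreteCategory.congr_hom h z

/-- The Kleisli extension of a map into a free model. -/
noncomputable def kleisli {X Y : Met.{u}} (q : X ⟶ T.obj Y) : freeModel hE X ⟶ freeModel hE Y :=
  freeModelMap hE q ≫ freeModelMul hE Y

theorem kleisli_unit {X Y : Met.{u}} (q : X ⟶ T.obj Y) (x : X) :
    ConcreteCategory.hom (kleisli hE q).map (ConcreteCategory.hom (T.η.app X) x) =
      ConcreteCategory.hom q x := by
  have h : T.η.app X ≫ T.map q ≫ T.μ.app Y = q := by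
    rw [← Category.assoc]
    refine (congrArg (· ≫ T.μ.app Y) (T.η.naturality q).symm).trans ?_
    rw [Category.assoc, T.left_unit, Category.comp_id]
    rfl
  exact ConcreteCategory.congr_hom h x

/-- The theory of all judgments that are valid in the free algebras. -/
noncomputable def theory : MetricTheory (signature T) where
  judgments := {j | ∀ X, (freeModel hE X).Sat j.ctx j.atom}
  wellFormed _ _ _ _ _ :=
    ⟨fun X => (freeModel hE X).sat_ok (signature_isDiscrete T) _ _,
      fun X => (freeModel hE X).sat_ok (signature_isDiscrete T) _ _⟩
  generated Γ φ := by
    refine ⟨fun h => ?_, fun h X =>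
      (freeModel hE X).sat_of_derivable (signature_isDiscrete T) (fun j hj => hj.1 X) h⟩
    cases φ with
    | eq s t ε => exact .ax ⟨h, s, t, ε, rfl⟩
    | ok t =>
      clear h
      induction t with
      | var x => exact .var Γ x
      | app f t ih =>
        refine .app f t ih fun i j δ hδ => ?_
        by_cases hij : i = j
        · subst hij
          rw [edist_self] at hδ
          obtain rfl : δ = 0 := by exact_mod_cast hδ.symm
          exact .refl (ih i)
        · rw [signature_isDiscrete T f i j hij] at hδ
          exact absurd hδ ENNReal.top_ne_coe

/-- The free algebras as models of the theory. -/
noncomputable def freeMod (X : Met.{u}) : (theory hE).Mod := ⟨freeModel hE X, fun _ hj => hj X⟩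

/-! ### The universal property of the free algebras -/

variable {hE}

/-- An inequality between the values of two preterms with variables in a space transfers from the
free algebras to all models of the theory. -/
theorem edist_evl_le {X : Met.{u}} {S : Set ℕ} {p : S → X} (hp : Function.Surjective p)
    {M : SigModel (signature T)} (hM : (theory hE).isModel M) {s t : Preterm (signature T)}
    {ε : ℝ≥0}
    (h : ∀ (Y : Met.{u}) (q : X ⟶ T.obj Y) (α : ℕ → (freeModel hE Y).space),
      (∀ i : S, α i = ConcreteCategory.hom q (p i)) →
        edist (evl (freeModel hE Y) α s) (evl (freeModel hE Y) α t) ≤ ε)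
    {f : X ⟶ M.space} {α : ℕ → M.space} (hα : ∀ i : S, α i = ConcreteCategory.hom f (p i)) :
    edist (evl M α s) (evl M α t) ≤ ε := by
  -- `Γ` records the finite distances of `X`, the variable `i ∈ S` naming the point `p i`.
  let Γ : MetContext :=
    {e | ∃ i j : S, e.lhs = i ∧ e.rhs = j ∧ edist (p i) (p j) ≤ e.bound}
  have hΓ : (⟨Γ, .eq s t ε⟩ : Judgment (signature T)) ∈ (theory hE).judgments := by
    intro Y
    rw [SigModel.sat_eq_iff (signature_isDiscrete T)]
    intro β hβ
    have hβ' : ∀ i j : S, edist (β i) (β j) ≤ edist (p i) (p j) := by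
      intro i j
      by_cases htop : edist (p i) (p j) = ⊤
      · rw [htop]; exact le_top
      · have := hβ ⟨i, j, (edist (p i) (p j)).toNNReal⟩
          ⟨i, j, rfl, rfl, (ENNReal.coe_toNNReal htop).ge⟩
        rwa [ENNReal.coe_toNNReal htop] at this
    -- An assignment satisfying `Γ` descends along `p` to a nonexpansive map on `X`: variables
    -- naming the same point get values at distance `0`.
    obtain ⟨r, hr⟩ := hp.hasRightInverse
    refine h Y (⟨fun x => β (r x), fun x y => ?_⟩ : NonexpMap X (T.obj Y)) β fun i => ?_
    · have := hβ' (r x) (r y)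
      rwa [hr, hr] at this
    · have := hβ' i (r (p i))
      rw [hr, edist_self] at this
      exact edist_le_zero.1 this
  refine (SigModel.sat_eq_iff (signature_isDiscrete T) _ _ _ _ _).1 (hM _ hΓ) α ?_
  rintro e ⟨i, j, hi, hj, hij⟩
  rw [hi, hj, hα, hα]
  exact (NonexpMap.nonexp f _ _).trans hij

/-- The Kleisli extension is a homomorphism restricting to `q` on generators. So in free algebras
the value depends on `z` only through its image in `T.obj X`. -/
theorem evl_varTerm_freeModel {X Y : Met.{u}} {S : Set ℕ} {p : S → X} {q : X ⟶ T.obj Y}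
    {α : ℕ → (freeModel hE Y).space} (hα : ∀ i : S, α i = ConcreteCategory.hom q (p i))
    (z : T.obj (disc S)) :
    evl (freeModel hE Y) α (varTerm z) = ConcreteCategory.hom (kleisli hE q).map
      (ConcreteCategory.hom (T.map (discHom p)) z) := by
  rw [map_discHom_eq_act hE, map_act]
  exact congrArg (act _ z) (funext fun i => (hα i).trans (kleisli_unit hE q (p i)).symm)

/-- Only the variables in `S` matter; `m` is a default for the others. -/
theorem exists_assignment {M : Type*} (m : M) {S : Set ℕ} (g : S → M) :
    ∃ α : ℕ → M, ∀ i : S, α i = g i :=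
  ⟨Function.extend Subtype.val g fun _ => m, fun i => Subtype.val_injective.extend_apply _ _ i⟩

/-- Maps from countable spaces to models extend to free models. -/
theorem exists_extension_of_countable (hT : PreservesSurjections T.toFunctor) (X : Met.{u})
    [Countable X] {M : SigModel (signature T)} (hM : (theory hE).isModel M) (f : X ⟶ M.space) :
    ∃ h : freeModel hE X ⟶ M, T.η.app X ≫ h.map = f := by
  obtain ⟨S, p, hp⟩ := exists_surjective X
  choose r hr using hT _ _ _ (discHom_surjective hp)
  -- The only possible value, since `r z` expresses `z` as an operation on the points `p i`.
  let H : T.obj X → M.space := fun z => act M (r z) fun i => ConcreteCategory.hom f (p i)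
  have hH : ∀ {α : ℕ → M.space}, (∀ i : S, α i = ConcreteCategory.hom f (p i)) →
      ∀ z, evl M α (varTerm (r z)) = H z := fun hα z => congrArg (act M _) (funext hα)
  have hF : ∀ {Y : Met.{u}} {q : X ⟶ T.obj Y} {α : ℕ → (freeModel hE Y).space},
      (∀ i : S, α i = ConcreteCategory.hom q (p i)) → ∀ z, evl (freeModel hE Y) α (varTerm (r z)) =
        ConcreteCategory.hom (kleisli hE q).map z := fun hα z => by
    rw [evl_varTerm_freeModel hα]
    exact congrArg _ (hr z)
  have hne : ∀ z w, edist (H z) (H w) ≤ edist z w := by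
    intro z w
    by_cases htop : edist z w = ⊤
    · rw [htop]; exact le_top
    obtain ⟨α, hα⟩ := exists_assignment (H z) fun i => ConcreteCategory.hom f (p i)
    rw [← ENNReal.coe_toNNReal htop, ← hH hα, ← hH hα]
    refine edist_evl_le hp hM (fun Y q β hβ => ?_) hα
    rw [hF hβ, hF hβ, ENNReal.coe_toNNReal htop]
    exact NonexpMap.nonexp (kleisli hE q).map z w
  -- The case `ε = 0`: identities holding in all free algebras transfer to `M`. They give
  -- compatibility with the operations and with the unit.
  have heq : ∀ {s t : Preterm (signature T)},
      (∀ (Y : Met.{u}) (q : X ⟶ T.obj Y) (α : ℕ → (freeModel hE Y).space),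
        (∀ i : S, α i = ConcreteCategory.hom q (p i)) →
          evl (freeModel hE Y) α s = evl (freeModel hE Y) α t) →
      ∀ {α : ℕ → M.space}, (∀ i : S, α i = ConcreteCategory.hom f (p i)) →
        evl M α s = evl M α t := by
    intro s t h α hα
    refine edist_le_zero.1 (edist_evl_le (ε := 0) hp hM (fun Y q β hβ => ?_) hα)
    rw [h Y q β hβ, edist_self]
    exact zero_le
  refine ⟨homOfMapAct (⟨H, hne⟩ : NonexpMap (T.obj X) M.space) fun S' z a => ?_, ?_⟩
  · obtain ⟨α, hα⟩ := exists_assignment (H (act (freeModel hE X) z a))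
      fun i => ConcreteCategory.hom f (p i)
    -- Two terms for one element of `T.obj X`: its chosen representative, and `z` applied to the
    -- representatives of the `a i`.
    have := heq (s := varTerm (r (act (freeModel hE X) z a)))
      (t := opTerm z fun i => varTerm (r (a i))) (fun Y q β hβ => by
        rw [hF hβ, map_act, evl_opTerm]
        simp only [hF hβ]) hα
    rw [evl_opTerm, hH hα] at this
    simp only [hH hα] at this
    exact this
  · refine ConcreteCategory.hom_ext _ _ fun x => ?_
    obtain ⟨i, rfl⟩ := hp x
    obtain ⟨α, hα⟩ := exists_assignment (ConcreteCategory.hom f (p i))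
      fun i => ConcreteCategory.hom f (p i)
    have := heq (s := varTerm (r (ConcreteCategory.hom (T.η.app X) (p i)))) (t := .var i)
      (fun Y q β hβ => by
        rw [hF hβ, kleisli_unit]
        exact (hβ i).symm) hα
    rw [hH hα] at this
    exact this.trans (hα i)

/-- The elements of a free algebra are values of operations on generators. -/
theorem exists_map_discHom (hA : HasCountableArity T.toFunctor)
    (hT : PreservesSurjections T.toFunctor) {X : Met.{u}} (z : T.obj X) :
    ∃ (S : Set ℕ) (z₀ : T.obj (disc S)) (g : S → X),
      ConcreteCategory.hom (T.map (discHom g)) z₀ = z := by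
  obtain ⟨hc⟩ := hA.preservesColimit X
  obtain ⟨A, x, hx⟩ := exists_of_isColimit hc z
  have : Countable (Met.of A.1) := A.2
  obtain ⟨S, p, hp⟩ := exists_surjective (Met.of A.1)
  obtain ⟨z₀, hz₀⟩ := hT _ _ _ (discHom_surjective hp) x
  refine ⟨S, z₀, fun i => (p i).1, ?_⟩
  have h : T.map (discHom fun i => (p i).1) = T.map (discHom p) ≫ T.map (incl A.1) := by
    rw [← T.map_comp]; rfl
  refine (ConcreteCategory.congr_hom h z₀).trans (Eq.trans ?_ hx)
  exact congrArg (ConcreteCategory.hom (T.map (incl A.1))) hz₀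

/-- Homomorphisms out of free models are determined by their values on generators. -/
theorem freeModel_hom_ext (hA : HasCountableArity T.toFunctor)
    (hT : PreservesSurjections T.toFunctor) {X : Met.{u}} {M : SigModel (signature T)}
    {h k : freeModel hE X ⟶ M} (H : T.η.app X ≫ h.map = T.η.app X ≫ k.map) : h = k := by
  refine SigModel.Hom.ext (ConcreteCategory.hom_ext _ _ fun z => ?_)
  obtain ⟨S, z₀, g, rfl⟩ := exists_map_discHom hA hT z
  rw [map_discHom_eq_act hE]
  refine (map_act h _ _).trans (Eq.trans ?_ (map_act k _ _).symm)
  exact congrArg (act M z₀) (funext fun i => ConcreteCategory.congr_hom H (g i))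

/-- The universal property of free models. -/
theorem exists_extension (hA : HasCountableArity T.toFunctor)
    (hT : PreservesSurjections T.toFunctor) (X : Met.{u})
    {M : SigModel (signature T)} (hM : (theory hE).isModel M) (f : X ⟶ M.space) :
    ∃ h : freeModel hE X ⟶ M, T.η.app X ≫ h.map = f := by
  have hex : ∀ A : CountableSubsets X, ∃ h : freeModel hE (Met.of A.1) ⟶ M,
      T.η.app (Met.of A.1) ≫ h.map = incl A.1 ≫ f := fun A =>
    have : Countable (Met.of A.1) := A.2
    exists_extension_of_countable hT _ hM _
  choose h hh using hex
  -- The extensions glue because homomorphisms out of free models are determined on generators.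
  have hcompat : ∀ {A B : CountableSubsets X} (l : A ⟶ B),
      freeModelMap hE ((countableDiagram X).map l) ≫ h B = h A := by
    intro A B l
    refine freeModel_hom_ext hA hT ?_
    rw [hh]
    refine (congrArg (· ≫ (h B).map)
      (T.η.naturality ((countableDiagram X).map l)).symm).trans ?_
    rw [Category.assoc]
    exact congrArg (_ ≫ ·) (hh B)
  obtain ⟨hc⟩ := hA.preservesColimit X
  let c : Cocone (countableDiagram X ⋙ T.toFunctor) :=
    { pt := M.space
      ι :=
        { app := fun A => (h A).map
          naturality := fun A B l => congrArg SigModel.Hom.map (hcompat l) } }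
  have hfac : ∀ A : CountableSubsets X, T.map (incl A.1) ≫ hc.desc c = (h A).map := hc.fac c
  refine ⟨homOfMapAct (hc.desc c) fun S z a => ?_, ?_⟩
  · choose A x hx using fun i => exists_of_isColimit hc (a i)
    obtain ⟨B, hB⟩ := exists_countable_le A
    let b : S → T.obj (Met.of B.1) := fun i =>
      ConcreteCategory.hom (T.map ((countableDiagram X).map (homOfLE (hB i)))) (x i)
    have hb : ∀ i, ConcreteCategory.hom (T.map (incl B.1)) (b i) = a i := by
      intro i
      refine Eq.trans ?_ (hx i)
      exact ConcreteCategory.congr_hom ((T.toFunctor.mapCocone (countableCocone X)).w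
        (homOfLE (hB i))) (x i)
    obtain rfl : (fun i => ConcreteCategory.hom (T.map (incl B.1)) (b i)) = a := funext hb
    have h1 := map_act (freeModelMap hE (incl B.1)) z b
    refine (congrArg (ConcreteCategory.hom (hc.desc c)) h1.symm).trans ?_
    refine (ConcreteCategory.congr_hom (hfac B) (act (freeModel hE (Met.of B.1)) z b)).trans ?_
    refine (map_act (h B) z b).trans (congrArg (act M z) (funext fun i => ?_))
    exact (ConcreteCategory.congr_hom (hfac B) (b i)).symm
  · refine (countableCoconeIsColimit X).hom_ext fun A => ?_
    refine Eq.trans ?_ (hh A)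
    rw [← hfac A, ← Category.assoc, ← Category.assoc]
    exact congrArg (· ≫ hc.desc c) (T.η.naturality (incl A.1))

/-! ### The free-model adjunction and its monad -/

variable (hE)

/-- The free model functor. -/
noncomputable def free : Met.{u} ⥤ (theory hE).Mod where
  obj X := freeMod hE X
  map f := ObjectProperty.homMk (freeModelMap hE f)
  map_id X := by
    refine ObjectProperty.hom_ext _ (SigModel.Hom.ext ?_)
    exact T.map_id X
  map_comp f g := by
    refine ObjectProperty.hom_ext _ (SigModel.Hom.ext ?_)
    exact T.map_comp f g

/-- The theory of the free algebras axiomatizes the monad. -/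
theorem theory_axiomatizes (hA : HasCountableArity T.toFunctor)
    (hT : PreservesSurjections T.toFunctor) : (theory hE).Axiomatizes T := by
  -- The counit is the extension of the identity of the underlying space.
  choose ε hε using fun M : (theory hE).Mod =>
    exists_extension (hE := hE) hA hT M.obj.space M.property (𝟙 _)
  let adj : free hE ⊣ (theory hE).forget := Adjunction.mkOfUnitCounit
    { unit := T.η
      counit :=
        { app := fun M => ObjectProperty.homMk (ε M)
          naturality := fun M N g => by
            refine ObjectProperty.hom_ext _ (freeModel_hom_ext (hE := hE) hA hT ?_)
            have h1 : T.η.app M.obj.space ≫ T.map g.hom.map ≫ (ε N).map = g.hom.map := by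
              rw [← Category.assoc]
              refine (congrArg (· ≫ (ε N).map) (T.η.naturality g.hom.map).symm).trans ?_
              rw [Category.assoc]
              exact congrArg (g.hom.map ≫ ·) (hε N)
            have h2 : T.η.app M.obj.space ≫ (ε M).map ≫ g.hom.map = g.hom.map := by
              rw [← Category.assoc, hε]
              exact Category.id_comp _
            exact h1.trans h2.symm }
      left_triangle := by
        refine NatTrans.ext (funext fun X => ObjectProperty.hom_ext _
          (freeModel_hom_ext (hE := hE) hA hT ?_))
        have h1 (k : T.obj (T.obj X) ⟶ T.obj X) (hk : T.η.app (T.obj X) ≫ k = 𝟙 _) :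
            T.η.app X ≫ T.map (T.η.app X) ≫ k = T.η.app X := by
          rw [← Category.assoc]
          refine (congrArg (· ≫ k) (T.η.naturality (T.η.app X)).symm).trans ?_
          rw [Category.assoc]
          exact congrArg (T.η.app X ≫ ·) hk
        exact h1 _ (hε (freeMod hE X))
      right_triangle := NatTrans.ext (funext fun M => hε M) }
  refine ⟨free hE, adj, ⟨MonadIso.mk (NatIso.ofComponents (fun X => Iso.refl (T.obj X))
    fun f => ?_) (fun X => ?_) fun X => ?_⟩⟩
  · exact (Category.comp_id _).trans (Category.id_comp _).symm
  · exact Category.comp_id _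
  -- The induced multiplication is `T.μ`: by the left unit law both homomorphisms restrict to the
  -- identity along the unit.
  · have h : ε (freeMod hE X) = freeModelMul hE X :=
      freeModel_hom_ext (hE := hE) hA hT ((hε (freeMod hE X)).trans (T.left_unit X).symm)
    have h1 : T.map (𝟙 (T.obj X)) ≫ 𝟙 (T.obj (T.obj X)) = 𝟙 (T.obj (T.obj X)) := by
      rw [T.map_id, Category.comp_id]
    refine (Category.comp_id _).trans ((congrArg SigModel.Hom.map h).trans ?_)
    refine Eq.trans ?_ (congrArg (· ≫ T.μ.app X) h1.symm)
    exact (Category.id_comp _).symm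

end MonadTheory

theorem mainTheorem3 (T : Monad Met.{u}) (hEnriched : IsMetEnriched T.toFunctor)
    (hArity : HasCountableArity T.toFunctor) :
    IsQETAxiomatizable T ↔ PreservesSurjections T.toFunctor := by
  constructor
  · rintro ⟨Ω, hΩ, 𝒯, F, adj, ⟨e⟩⟩
    exact (𝒯.surjective_of_adjunction hΩ adj).of_iso (MonadIso.toNatIso e)
  · exact fun hT => ⟨MonadTheory.signature T, MonadTheory.signature_isDiscrete T,
      MonadTheory.theory hEnriched, MonadTheory.theory_axiomatizes hEnriched hArity hT⟩
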